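/- Let $k$ be a field of characteristic $2$ and let $V_4=\langle\sigma,\tau \mid \sigma^2=\tau^2=(\sigma\tau)^2=e\rangle$ be the Klein four-group. All modules are finitely generated left modules. For a finite group $G$ and a prime $p=\operatorname{char}(k)$, a $kG$-module is a *$p$-permutation module* if it has a $k$-basis closed under the action of a Sylow $p$-subgroup of $G$ (for $G=V_4$ and $p=2$ this is the same as a permutation module, i.e. one with a $k$-basis closed under the action of $G$). The *$p$-permutation dimension* $\operatorname{ppdim}(M)$ of a $kG$-module $M$ is the minimal length $\sup\{i : P_i\neq 0\}$ of an exact complex $\cdots\to P_2\to P_1\to P_0\to M\to 0$ in which all $P_i$ are $p$-permutation modules. Put $a=\sigma+e$ and $b=\tau+e$ in $kV_4$, so that $kV_4\cong k[a,b]/\langle a^2,b^2\rangle$. For $n\ge 1$ and $f\in k[t]$ monic irreducible, write $f^n=t^m+\sum_{i=0}^{m-1}\alpha_i t^i$ with $m=n\deg f$, and let $E_{f,n}$ be the $kV_4$-module with $k$-basis $u_0,\dots,u_{m-1},v_0,\dots,v_{m-1}$ and action $$a u_i=v_i\ (0\le i\le m-1),\quad b u_i=v_{i+1}\ (0\le i\le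 m-2),\quad b u_{m-1}=\sum_{i=0}^{m-1}\alpha_i v_i,\quad a v_i=b v_i=0 .$$ **Theorem.** Let $n\ge 1$ and let $f\in k[t]$ be a monic irreducible polynomial with $f\ne t$ and $f\ne t+1$. Then $\operatorname{ppdim}(E_{f,n})=2$. -/

import Mathlib

open Polynomial

universe u v w

/-! ### `p`-permutation modules and the `p`-permutation dimension -/

section PPermutation

variable {k : Type u} {G : Type v} [Field k] [Group G]

/-- A finitely generated representation is a `p`-permutation module if it has a `k`-basis closed
under the action of a Sylow `p`-subgroup of `G`. -/
def IsPPermutation (p : ℕ) (M : Rep.{w} k G) : Prop :=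
  Module.Finite k M ∧
    ∃ (P : Sylow p G) (ι : Type w) (b : Module.Basis ι k M),
      ∀ g ∈ P, ∀ i, ∃ j, M.ρ g (b i) = b j

/-- A finitely generated representation is a permutation module if it has a `k`-basis closed
under the action of `G`. -/
def IsPermutation (M : Rep.{w} k G) : Prop :=
  Module.Finite k M ∧
    ∃ (ι : Type w) (b : Module.Basis ι k M), ∀ (g : G) (i : ι), ∃ j, M.ρ g (b i) = b j

/-- For a `p`-group, `p`-permutation modules and permutation modules are the same thing. -/
theorem isPPermutation_iff_isPermutation {p : ℕ} (hG : IsPGroup p G) (M : Rep.{w} k G) :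
    IsPPermutation p M ↔ IsPermutation M := by
  constructor
  · rintro ⟨hfin, P, ι, b, h⟩
    refine ⟨hfin, ι, b, fun g i => h g ?_ i⟩
    have hP : (P : Subgroup G) = ⊤ :=
      (P.is_maximal' (hG.to_subgroup ⊤) le_top).symm
    have : g ∈ (P : Subgroup G) := hP ▸ Subgroup.mem_top g
    exact this
  · rintro ⟨hfin, ι, b, h⟩
    exact ⟨hfin, default, ι, b, fun g _ i => h g i⟩

/-- A `p`-permutation resolution of `M`: an exact complex
`⋯ ⟶ X 2 ⟶ X 1 ⟶ X 0 ⟶ M ⟶ 0` in which every `X i` is a `p`-permutation module. -/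
structure PPermResolution (p : ℕ) (M : Rep.{w} k G) where
  X : ℕ → Rep.{w} k G
  d : ∀ i, X (i + 1) ⟶ X i
  ε : X 0 ⟶ M
  isPPermutation : ∀ i, IsPPermutation p (X i)
  exact_succ : ∀ i, Function.Exact (d (i + 1)).hom (d i).hom
  exact_zero : Function.Exact (d 0).hom ε.hom
  surjective : Function.Surjective ε.hom

/-- The length `sup {i | X i ≠ 0}` of a resolution. -/
noncomputable def PPermResolution.length {p : ℕ} {M : Rep.{w} k G} (R : PPermResolution p M) :
    ℕ∞ :=
  ⨆ (i : ℕ) (_ : Nontrivial (R.X i)), (i : ℕ∞)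

/-- The `p`-permutation dimension of `M`: the minimal length of a `p`-permutation resolution
(and `⊤` if there is none of finite length). -/
noncomputable def ppdim (p : ℕ) (M : Rep.{w} k G) : ℕ∞ :=
  ⨅ R : PPermResolution p M, R.length

end PPermutation

/-! ### The Klein four-group and its representations in characteristic two -/

/-- The Klein four-group. -/
abbrev KleinFour : Type := Multiplicative (ZMod 2 × ZMod 2)

namespace KleinFour

/-- The first generator. -/
def σ : KleinFour := Multiplicative.ofAdd (1, 0)

/-- The second generator. -/
def τ : KleinFour := Multiplicative.ofAdd (0, 1)

theorem relations : σ ^ 2 = 1 ∧ τ ^ 2 = 1 ∧ (σ * τ) ^ 2 = 1 := by decide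

theorem eq_or (g : KleinFour) : g = 1 ∨ g = σ ∨ g = τ ∨ g = σ * τ := by
  revert g; decide

section Rep

variable {k : Type u} {V : Type w} [Field k] [CharP k 2] [AddCommGroup V] [Module k V]

theorem one_add_sq (a : Module.End k V) (ha : a * a = 0) : (1 + a) ^ 2 = 1 := by
  have h2 : a + a = 0 := by
    rw [← two_smul k a, CharTwo.two_eq_zero, zero_smul]
  calc (1 + a) ^ 2 = 1 + (a + a) + a * a := by noncomm_ring
    _ = 1 := by rw [h2, ha]; simp

/-- A vector space in characteristic two with commuting square-zero endomorphisms `a`, `b`,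
that is, a module over `k[a, b] / (a², b²)`, viewed as a representation of the Klein four-group
through `a = σ + 1`, `b = τ + 1`. -/
def rep (a b : Module.End k V) (ha : a * a = 0) (hb : b * b = 0) (hab : Commute a b) :
    Representation k KleinFour V where
  toFun g := (1 + a) ^ (Multiplicative.toAdd g).1.val * (1 + b) ^ (Multiplicative.toAdd g).2.val
  map_one' := by simp
  map_mul' g h := by
    have hc : Commute (1 + a) (1 + b) :=
      (Commute.one_left _).add_left ((Commute.one_right _).add_right hab)
    simp only [toAdd_mul, Prod.fst_add, Prod.snd_add, ZMod.val_add,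
      ← pow_eq_pow_mod _ (one_add_sq a ha), ← pow_eq_pow_mod _ (one_add_sq b hb), pow_add]
    have := (hc.pow_pow (Multiplicative.toAdd h).1.val (Multiplicative.toAdd g).2.val).eq
    simp only [mul_assoc]
    congr 1
    simp only [← mul_assoc]
    rw [this]

theorem rep_σ (a b : Module.End k V) (ha : a * a = 0) (hb : b * b = 0) (hab : Commute a b) :
    rep a b ha hb hab σ = 1 + a := by
  simp [rep, σ, ZMod.val_one]

theorem rep_τ (a b : Module.End k V) (ha : a * a = 0) (hb : b * b = 0) (hab : Commute a b) :
    rep a b ha hb hab τ = 1 + b := by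
  simp [rep, τ, ZMod.val_one]

end Rep

end KleinFour

/-! ### The modules `E_{f,n}` -/

namespace EModule

variable {k : Type u} [Field k]

/-- For `q = t ^ m + ∑ α_j t ^ j` of degree `m`, the image `b u_i` in terms of the `v_j`:
it is `v_{i+1}` if `i < m - 1`, and `∑ α_j v_j` if `i = m - 1`. -/
noncomputable def bImage (q : k[X]) (i : Fin q.natDegree) : Fin q.natDegree → k :=
  if h : (i : ℕ) + 1 < q.natDegree then Pi.single ⟨i + 1, h⟩ 1 else fun j => q.coeff j

/-- The action of `a` on the space with basis `u_i = (e_i, 0)`, `v_i = (0, e_i)`: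
`a u_i = v_i` and `a v_i = 0`. -/
def a (k : Type u) [Field k] (m : ℕ) : Module.End k ((Fin m → k) × (Fin m → k)) :=
  LinearMap.inr k _ _ ∘ₗ LinearMap.fst k _ _

/-- The action of `b`: `b u_i = bImage q i` and `b v_i = 0`. -/
noncomputable def b (q : k[X]) :
    Module.End k ((Fin q.natDegree → k) × (Fin q.natDegree → k)) :=
  LinearMap.inr k _ _ ∘ₗ Fintype.linearCombination k (bImage q) ∘ₗ LinearMap.fst k _ _

theorem a_u (m : ℕ) (i : Fin m) : a k m (Pi.single i 1, 0) = (0, Pi.single i 1) := rfl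

theorem a_v (m : ℕ) (i : Fin m) : a k m (0, Pi.single i 1) = 0 := rfl

theorem b_u (q : k[X]) (i : Fin q.natDegree) : b q (Pi.single i 1, 0) = (0, bImage q i) := by
  simp [b]

theorem b_v (q : k[X]) (i : Fin q.natDegree) : b q (0, Pi.single i 1) = 0 := by
  simp [b]

theorem a_mul_a (m : ℕ) : a k m * a k m = 0 := rfl

theorem b_mul_b (q : k[X]) : b q * b q = 0 := by
  ext <;> simp [b]

theorem commute_a_b (q : k[X]) : Commute (a k q.natDegree) (b q) := by
  have h1 : a k q.natDegree * b q = 0 := rfl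
  have h2 : b q * a k q.natDegree = 0 := by ext <;> simp [a, b]
  exact h1.trans h2.symm

end EModule

/-- The module `E_{f,n}` over the group algebra of the Klein four-group: with
`f ^ n = t ^ m + ∑ α_j t ^ j`, it has basis `u_i`, `v_i` (`0 ≤ i < m`) and `a = σ + 1`, `b = τ + 1`
act by `a u_i = v_i`, `b u_i = v_{i+1}` for `i < m - 1`, `b u_{m-1} = ∑ α_j v_j`,
`a v_i = b v_i = 0`. -/
noncomputable def EModule {k : Type u} [Field k] [CharP k 2] (f : k[X]) (n : ℕ) :
    Rep.{u} k KleinFour :=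
  Rep.of (KleinFour.rep (EModule.a k (f ^ n).natDegree) (EModule.b (f ^ n))
    (EModule.a_mul_a _) (EModule.b_mul_b _) (EModule.commute_a_b _))

/-!
Write `N_g = 1 + g` for `g ≠ 1` in the Klein four-group `V₄`, let `N = N_σ N_τ` be the norm of `V₄`,
and put `U = k[t] / (f ^ n)`, so that `E = E_{f,n}` is `U ⊕ U` with `a (u, v) = (0, u)` and
`b (u, v) = (0, t u)`.

Upper bound. Covering `E` by `k[V₄] ⊗ U` from its top and adding a copy of `U` that maps onto its
socle makes the kernel isomorphic to `rad (k[V₄]) ⊗ U`. The radical is the sum of the ideals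
generated by `a` and by `b`, which are the permutation modules `k[V₄/σ]` and `k[V₄/τ]` and meet in
the one-dimensional socle. This gives an exact sequence
`0 → U → (k[V₄/σ] ⊕ k[V₄/τ]) ⊗ U → k[V₄] ⊗ U ⊕ U → E → 0`; the three maps are `constants`,
`syzygy` and `augmentation`.

Lower bound. Suppose that `0 → P₁ → P₀ → E → 0` is exact with permutation modules `P₁` and `P₀`. As
neither `0` nor `1` is a root of `f`, the maps `t` and `t + 1` are invertible on `U`, so that `E` is
free over each of `⟨σ⟩`, `⟨τ⟩` and `⟨στ⟩` (`mem_range_pairNorm_rho`); moreover `N E = 0`. Three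
consequences are drawn, where `φ` denotes the map `P₁ → P₀`.

* An element of `P₁` with image in `N_g P₀` lies in `N_g P₁`, and
  `rank N_g(P₀) = rank N_g(P₁) + dim E / 2`.
* `N P₀` lies in the image of `P₁`, hence in `φ (⋂ N_g P₁)`, and on a permutation module
  `⋂ N_g P₁ = N P₁` (`mem_range_fullNorm`). So `rank N(P₀) ≤ rank N(P₁)`.
* The numbers `c₁` and `c₀` of basis vectors fixed by `V₄` satisfy `c₁ ≤ c₀`, as `φ` is injective on
  the quotient of the invariants by the traces from proper subgroups (`card_fixed_le`).

Counting orbits in a permutation basis yields `dim P + 2 rank N = c + ∑ rank N_g`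
(`finrank_add_two_mul_finrank_range_fullNorm`). The difference of these identities for `P₀` and `P₁`
is `2 (rank N(P₀) - rank N(P₁)) = (c₀ - c₁) + dim E / 2`, whose left side is at most `0` and whose
right side is positive (`not_exact_of_permutation`).
-/

/-! ### Norms in representations of the Klein four-group -/

namespace KleinFour

/-- The norm `1 + g` of the subgroup `{1, g}`, acting on a representation. -/
def pairNorm {k V : Type*} [Field k] [AddCommGroup V] [Module k V]
    (ρ : Representation k KleinFour V) (g : KleinFour) : Module.End k V := 1 + ρ g

/-- The norm `(1 + σ)(1 + τ) = 1 + σ + τ + στ` of the whole group, acting on a representation. -/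
def fullNorm {k V : Type*} [Field k] [AddCommGroup V] [Module k V]
    (ρ : Representation k KleinFour V) : Module.End k V := pairNorm ρ σ * pairNorm ρ τ

theorem mul_self (g : KleinFour) : g * g = 1 := by revert g; decide

section Norms

variable {k V W : Type*} [Field k] [AddCommGroup V] [Module k V] [AddCommGroup W] [Module k W]
  {ρ : Representation k KleinFour V} {ρ' : Representation k KleinFour W}

theorem pairNorm_apply (g : KleinFour) (v : V) : pairNorm ρ g v = v + ρ g v := rfl

theorem fullNorm_apply (v : V) : fullNorm ρ v = pairNorm ρ σ (pairNorm ρ τ v) := rfl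

theorem rho_mul_apply (g h : KleinFour) (v : V) : ρ g (ρ h v) = ρ (g * h) v := by
  rw [map_mul]; rfl

theorem rho_rho (g : KleinFour) (v : V) : ρ g (ρ g v) = v := by
  rw [rho_mul_apply, mul_self, map_one]; rfl

theorem pairNorm_comm (g h : KleinFour) (v : V) :
    pairNorm ρ g (pairNorm ρ h v) = pairNorm ρ h (pairNorm ρ g v) := by
  simp only [pairNorm_apply, map_add, rho_mul_apply, mul_comm g h]
  abel

theorem map_pairNorm (φ : ρ.IntertwiningMap ρ') (g : KleinFour) (v : V) :
    φ (pairNorm ρ g v) = pairNorm ρ' g (φ v) := by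
  rw [pairNorm_apply, pairNorm_apply, map_add, φ.isIntertwining]

theorem map_fullNorm (φ : ρ.IntertwiningMap ρ') (v : V) :
    φ (fullNorm ρ v) = fullNorm ρ' (φ v) := by
  rw [fullNorm_apply, fullNorm_apply, map_pairNorm, map_pairNorm]

theorem fullNorm_eq_pairNorm_στ (v : V) :
    fullNorm ρ v = pairNorm ρ (σ * τ) (pairNorm ρ σ v) := by
  have h : σ * τ * σ = τ := by decide
  simp only [fullNorm_apply, pairNorm_apply, map_add, rho_mul_apply, h]
  abel

variable [CharP k 2]

theorem add_self_eq_zero (k : Type*) {V : Type*} [Field k] [AddCommGroup V] [Module k V]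
    [CharP k 2] (v : V) : v + v = 0 := by
  rw [← two_smul k v, CharTwo.two_eq_zero, zero_smul]

theorem pairNorm_pairNorm (g : KleinFour) (v : V) : pairNorm ρ g (pairNorm ρ g v) = 0 := by
  simp only [pairNorm_apply, map_add, rho_rho]
  rw [add_comm v, add_self_eq_zero k]

theorem pairNorm_eq_zero_iff (g : KleinFour) (v : V) : pairNorm ρ g v = 0 ↔ ρ g v = v := by
  rw [pairNorm_apply]
  constructor
  · intro h
    have := congrArg (v + ·) h
    simpa [← add_assoc, add_self_eq_zero k] using this
  · intro h
    rw [h, add_self_eq_zero k]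

end Norms

/-- An endomorphism that sums the coordinates over the fibres of `p` in `Y`, all of the same size
`q`, and kills the coordinates outside `Y`, has as rank the number of those fibres. -/
theorem finrank_range_mul_of_fibre_sum {Q k V ι : Type*} [DecidableEq Q] [Field k]
    [AddCommGroup V] [Module k V] [Fintype ι] {b : Module.Basis ι k V} (T : Module.End k V)
    (p : ι → Q) (Y : Finset ι) (q : ℕ) (hq : ∀ j ∈ Y, (Y.filter (p · = p j)).card = q)
    (hin : ∀ v, ∀ j ∈ Y, b.equivFun (T v) j = ∑ i ∈ Y.filter (p · = p j), b.equivFun v i)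
    (hout : ∀ v, ∀ j ∉ Y, b.equivFun (T v) j = 0) :
    Module.finrank k (LinearMap.range T) * q = Y.card := by
  classical
  let R : V →ₗ[k] (Y.image p → k) :=
    LinearMap.pi fun z => ∑ i ∈ Y.filter (p · = z), LinearMap.proj i ∘ₗ b.equivFun.toLinearMap
  let S : (Y.image p → k) →ₗ[k] V := b.equivFun.symm.toLinearMap ∘ₗ
    LinearMap.pi fun j => if h : j ∈ Y then
      LinearMap.proj ⟨p j, Finset.mem_image_of_mem p h⟩ else 0
  have hSc : ∀ f j, b.equivFun (S f) j = if h : j ∈ Y then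
      f ⟨p j, Finset.mem_image_of_mem p h⟩ else 0 := by
    intro f j
    simp only [S, LinearMap.comp_apply, LinearEquiv.coe_coe, LinearEquiv.apply_symm_apply,
      LinearMap.pi_apply]
    split_ifs <;> rfl
  have hTSR : T = S ∘ₗ R := by
    ext v
    apply b.equivFun.injective
    ext j
    rw [LinearMap.comp_apply, hSc]
    by_cases hj : j ∈ Y
    · rw [dif_pos hj, hin v j hj]
      simp [R]
    · rw [dif_neg hj, hout v j hj]
  have hS : Function.Injective S := by
    rw [injective_iff_map_eq_zero]
    rintro f hf
    ext ⟨z, hz⟩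
    obtain ⟨j, hj, rfl⟩ := Finset.mem_image.1 hz
    have := congrFun (congrArg b.equivFun hf) j
    rw [hSc, dif_pos hj] at this
    simpa using this
  have hR : LinearMap.range R = ⊤ := by
    have hsec : ∀ z : Y.image p, ∃ j ∈ Y, p j = z := fun z => Finset.mem_image.1 z.2
    choose s hsY hs using hsec
    rw [LinearMap.range_eq_top]
    intro f
    refine ⟨b.equivFun.symm fun i =>
      if h : i ∈ Y then
        (if s ⟨p i, Finset.mem_image_of_mem p h⟩ = i then f ⟨p i, Finset.mem_image_of_mem p h⟩
          else 0) else 0, ?_⟩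
    ext z
    simp only [R, LinearMap.pi_apply, LinearMap.sum_apply, LinearMap.comp_apply,
      LinearEquiv.coe_coe, LinearEquiv.apply_symm_apply, LinearMap.proj_apply]
    rw [Finset.sum_eq_single (s z)]
    · have : (⟨p (s z), Finset.mem_image_of_mem p (hsY z)⟩ : Y.image p) = z := Subtype.ext (hs z)
      simp [hsY, this]
    · intro i hi hne
      obtain ⟨hiY, hi⟩ := Finset.mem_filter.1 hi
      have : (⟨p i, Finset.mem_image_of_mem p hiY⟩ : Y.image p) = z := Subtype.ext hi
      simp [hiY, this, hne.symm]
    · intro h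
      exact absurd (Finset.mem_filter.2 ⟨hsY z, hs z⟩) h
  rw [hTSR, LinearMap.range_comp_of_range_eq_top _ hR, LinearMap.finrank_range_of_inj hS,
    Module.finrank_fintype_fun_eq_card, Fintype.card_coe,
    Finset.card_eq_sum_card_image p Y, Finset.sum_const_nat]
  intro z hz
  obtain ⟨j, hj, rfl⟩ := Finset.mem_image.1 hz
  exact hq j hj

/-! ### Coordinates in a permutation module -/

section Permutation

variable {k V ι : Type*} [Field k] [AddCommGroup V] [Module k V] [Fintype ι]
  {ρ : Representation k KleinFour V} [MulAction KleinFour ι] {b : Module.Basis ι k V}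

/-- The coordinates are permuted by `g⁻¹`, which equals `g`. -/
theorem coord_rho (hb : ∀ (g : KleinFour) i, ρ g (b i) = b (g • i)) (g : KleinFour) (v : V)
    (i : ι) : b.equivFun (ρ g v) i = b.equivFun v (g • i) := by
  have key : b.equivFun.toLinearMap ∘ₗ ρ g =
      LinearMap.funLeft k k (fun i => g • i) ∘ₗ b.equivFun.toLinearMap := by
    classical
    refine b.ext fun j => ?_
    ext i
    have : g • j = i ↔ j = g • i := by
      constructor
      · rintro rfl; rw [smul_smul, mul_self, one_smul]
      · rintro rfl; rw [smul_smul, mul_self, one_smul]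
    simp [hb, LinearMap.funLeft_apply, Module.Basis.equivFun_apply, Finsupp.single_apply, this]
  exact congrFun (LinearMap.congr_fun key v) i

theorem coord_pairNorm (hb : ∀ (g : KleinFour) i, ρ g (b i) = b (g • i)) (g : KleinFour) (v : V)
    (i : ι) : b.equivFun (pairNorm ρ g v) i = b.equivFun v i + b.equivFun v (g • i) := by
  rw [pairNorm_apply, map_add, Pi.add_apply, coord_rho hb]

theorem coord_fullNorm (hb : ∀ (g : KleinFour) i, ρ g (b i) = b (g • i)) (v : V) (i : ι) :
    b.equivFun (fullNorm ρ v) i = ∑ g : KleinFour, b.equivFun v (g • i) := by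
  have h : (Finset.univ : Finset KleinFour) = {1, σ, τ, σ * τ} := by decide
  rw [fullNorm_apply, coord_pairNorm hb, coord_pairNorm hb, coord_pairNorm hb, h,
    Finset.sum_insert (by decide), Finset.sum_insert (by decide), Finset.sum_insert (by decide),
    Finset.sum_singleton, one_smul, smul_smul, mul_comm τ σ]
  ring

variable [CharP k 2]

theorem finrank_range_pairNorm [DecidableEq ι] (hb : ∀ (g : KleinFour) i, ρ g (b i) = b (g • i))
    (g : KleinFour) :
    Module.finrank k (LinearMap.range (pairNorm ρ g)) * 2 =
      (Finset.univ.filter fun i : ι => g • i ≠ i).card := by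
  have hgg (i : ι) : g • g • i = i := by rw [smul_smul, mul_self, one_smul]
  have hfib : ∀ j ∈ Finset.univ.filter (fun i : ι => g • i ≠ i),
      (Finset.univ.filter fun i : ι => g • i ≠ i).filter
        (fun i => ({i, g • i} : Finset ι) = {j, g • j}) = {j, g • j} := by
    intro j hj
    have hj' : g • j ≠ j := by simpa using hj
    ext i
    simp only [Finset.mem_filter, Finset.mem_univ, true_and, Finset.mem_insert,
      Finset.mem_singleton]
    constructor
    · rintro ⟨-, h⟩
      have : i ∈ ({j, g • j} : Finset ι) := h ▸ Finset.mem_insert_self _ _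
      simpa using this
    · rintro (rfl | rfl)
      · exact ⟨hj', rfl⟩
      · rw [hgg]
        exact ⟨hj'.symm, Finset.pair_comm _ _⟩
  -- the orbits of `g` are the fibres of `i ↦ {i, g i}`
  refine finrank_range_mul_of_fibre_sum (b := b) (pairNorm ρ g)
    (fun i => ({i, g • i} : Finset ι)) _ 2 ?_ ?_ ?_
  · intro j hj
    rw [hfib j hj, Finset.card_pair]
    simpa using Ne.symm (Finset.mem_filter.1 hj).2
  · intro v j hj
    rw [hfib j hj, coord_pairNorm hb, Finset.sum_pair (Finset.mem_filter.1 hj).2.symm]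
  · intro v j hj
    have hj' : g • j = j := by simpa using hj
    rw [coord_pairNorm hb, hj', CharTwo.add_self_eq_zero]

/-- The full norm is a multiple of the norm of each subgroup of order two, so it has no component
at a basis vector with nontrivial stabilizer. -/
theorem coord_fullNorm_eq_zero (hb : ∀ (g : KleinFour) i, ρ g (b i) = b (g • i)) (v : V) {i : ι}
    (hi : ¬ (σ • i ≠ i ∧ τ • i ≠ i ∧ (σ * τ) • i ≠ i)) : b.equivFun (fullNorm ρ v) i = 0 := by
  have : σ • i = i ∨ τ • i = i ∨ (σ * τ) • i = i := by tauto
  rcases this with h | h | h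
  · rw [fullNorm_apply, coord_pairNorm hb, h, CharTwo.add_self_eq_zero]
  · rw [fullNorm_apply, pairNorm_comm, coord_pairNorm hb, h, CharTwo.add_self_eq_zero]
  · rw [fullNorm_eq_pairNorm_στ, coord_pairNorm hb, h, CharTwo.add_self_eq_zero]

theorem finrank_range_fullNorm [DecidableEq ι] (hb : ∀ (g : KleinFour) i, ρ g (b i) = b (g • i)) :
    Module.finrank k (LinearMap.range (fullNorm ρ)) * 4 =
      (Finset.univ.filter fun i : ι => σ • i ≠ i ∧ τ • i ≠ i ∧ (σ * τ) • i ≠ i).card := by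
  have hfree : ∀ j : ι, (σ • j ≠ j ∧ τ • j ≠ j ∧ (σ * τ) • j ≠ j) ↔
      ∀ h : KleinFour, h • j = j → h = 1 := by
    intro j
    constructor
    · rintro ⟨h1, h2, h3⟩ h hj
      rcases eq_or h with rfl | rfl | rfl | rfl
      exacts [rfl, absurd hj h1, absurd hj h2, absurd hj h3]
    · intro h
      exact ⟨fun e => absurd (h _ e) (by decide), fun e => absurd (h _ e) (by decide),
        fun e => absurd (h _ e) (by decide)⟩
  let orb : ι → Finset ι := fun j => Finset.univ.image fun h : KleinFour => h • j
  have hinj : ∀ j : ι, (σ • j ≠ j ∧ τ • j ≠ j ∧ (σ * τ) • j ≠ j) →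
      Function.Injective fun h : KleinFour => h • j := by
    intro j hj x y hxy
    have h1 : (y⁻¹ * x) • j = j := by
      rw [mul_smul, show x • j = y • j from hxy, inv_smul_smul]
    exact (inv_mul_eq_one.1 ((hfree j).1 hj _ h1)).symm
  have hfib : ∀ j ∈ Finset.univ.filter
        (fun i : ι => σ • i ≠ i ∧ τ • i ≠ i ∧ (σ * τ) • i ≠ i),
      (Finset.univ.filter fun i : ι => σ • i ≠ i ∧ τ • i ≠ i ∧ (σ * τ) • i ≠ i).filter
        (fun i => orb i = orb j) = orb j := by
    intro j hj
    have hj' := (hfree j).1 (Finset.mem_filter.1 hj).2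
    ext i
    rw [Finset.mem_filter, Finset.mem_filter, hfree]
    constructor
    · rintro ⟨-, h⟩
      exact h ▸ Finset.mem_image.2 ⟨1, Finset.mem_univ _, one_smul _ _⟩
    · intro h
      obtain ⟨x, -, rfl⟩ := Finset.mem_image.1 h
      refine ⟨⟨Finset.mem_univ _, fun y hy => hj' y ?_⟩, ?_⟩
      · rw [smul_smul, mul_comm, mul_smul] at hy
        exact smul_left_cancel x hy
      · ext z
        simp only [orb, Finset.mem_image, Finset.mem_univ, true_and, smul_smul]
        exact ⟨fun ⟨y, hy⟩ => ⟨y * x, hy⟩, fun ⟨y, hy⟩ => ⟨y * x, by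
          rw [mul_assoc, mul_self, mul_one, hy]⟩⟩
  refine finrank_range_mul_of_fibre_sum (b := b) (fullNorm ρ) orb _ 4 ?_ ?_ ?_
  · intro j hj
    rw [hfib j hj, Finset.card_image_of_injective _ (hinj j (Finset.mem_filter.1 hj).2)]
    decide
  · intro v j hj
    rw [hfib j hj, coord_fullNorm hb,
      Finset.sum_image fun x _ y _ h => hinj j (Finset.mem_filter.1 hj).2 h]
  · intro v j hj
    exact coord_fullNorm_eq_zero hb v fun h => hj (Finset.mem_filter.2 ⟨Finset.mem_univ _, h⟩)

/-- In the dimension of a permutation module, the orbits with stabilizer of order two and the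
regular orbits are accounted for by the ranks of the norms, so that the number of fixed points is
determined by the dimension and these ranks. -/
theorem finrank_add_two_mul_finrank_range_fullNorm [DecidableEq ι]
    (hb : ∀ (g : KleinFour) i, ρ g (b i) = b (g • i)) :
    Module.finrank k V + 2 * Module.finrank k (LinearMap.range (fullNorm ρ)) =
      (Finset.univ.filter fun i : ι => σ • i = i ∧ τ • i = i).card +
        (Module.finrank k (LinearMap.range (pairNorm ρ σ)) +
          Module.finrank k (LinearMap.range (pairNorm ρ τ)) +
          Module.finrank k (LinearMap.range (pairNorm ρ (σ * τ)))) := by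
  have h1 := finrank_range_pairNorm hb σ
  have h2 := finrank_range_pairNorm hb τ
  have h3 := finrank_range_pairNorm hb (σ * τ)
  have h4 := finrank_range_fullNorm hb
  have h5 : Module.finrank k V = Fintype.card ι := Module.finrank_eq_card_basis b
  have key : 2 * Fintype.card ι +
      (Finset.univ.filter fun i : ι => σ • i ≠ i ∧ τ • i ≠ i ∧ (σ * τ) • i ≠ i).card =
      2 * (Finset.univ.filter fun i : ι => σ • i = i ∧ τ • i = i).card +
      ((Finset.univ.filter fun i : ι => σ • i ≠ i).card +
        (Finset.univ.filter fun i : ι => τ • i ≠ i).card +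
        (Finset.univ.filter fun i : ι => (σ * τ) • i ≠ i).card) := by
    -- the contributions agree at every basis vector, by the order of its stabilizer
    rw [← Finset.card_univ, Finset.card_eq_sum_ones]
    simp only [Finset.card_filter, Finset.mul_sum, ← Finset.sum_add_distrib]
    refine Finset.sum_congr rfl fun i _ => ?_
    by_cases hs : σ • i = i <;> by_cases ht : τ • i = i
    · simp [hs, ht, mul_smul]
    · have : (σ * τ) • i ≠ i := by rwa [mul_comm, mul_smul, hs]
      simp [hs, ht, this]
    · have : (σ * τ) • i ≠ i := by rwa [mul_smul, ht]
      simp [hs, ht, this]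
    · by_cases hst : (σ * τ) • i = i <;> simp [hs, ht, hst]
  omega

end Permutation

/-! ### Lifting invariants through norms -/

section Lift

variable {k V ι : Type*} [Field k] [AddCommGroup V] [Module k V] [Fintype ι]
  {ρ : Representation k KleinFour V} [MulAction KleinFour ι] {b : Module.Basis ι k V}

theorem mem_range_pairNorm (hb : ∀ (g : KleinFour) i, ρ g (b i) = b (g • i)) {g : KleinFour}
    {v : V} (hv : ρ g v = v) (h0 : ∀ i, g • i = i → b.equivFun v i = 0) :
    v ∈ LinearMap.range (pairNorm ρ g) := by
  let _ : LinearOrder ι := LinearOrder.lift' (Fintype.equivFin ι) (Fintype.equivFin ι).injective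
  -- an order on the basis selects one element of each orbit of `g`
  refine ⟨b.equivFun.symm fun i => if i < g • i then b.equivFun v i else 0, ?_⟩
  apply b.equivFun.injective
  ext i
  have hgg : g • g • i = i := by rw [smul_smul, mul_self, one_smul]
  have hvi : b.equivFun v (g • i) = b.equivFun v i := by rw [← coord_rho hb, hv]
  rw [coord_pairNorm hb, LinearEquiv.apply_symm_apply, hgg, hvi]
  rcases lt_trichotomy i (g • i) with h | h | h
  · rw [if_pos h, if_neg h.not_gt, add_zero]
  · rw [h0 i h.symm]; simp
  · rw [if_pos h, if_neg h.not_gt, zero_add]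

/-- Over the orbits on which `τ` and `στ` act without fixed points, an invariant vector is the
trace of a `σ`-invariant one. -/
theorem exists_pairNorm_τ_eq (hb : ∀ (g : KleinFour) i, ρ g (b i) = b (g • i)) {v : V}
    (hσ : ρ σ v = v) (hτ : ρ τ v = v) :
    ∃ w, ρ σ w = w ∧ (∀ i, b.equivFun v i = 0 → b.equivFun w i = 0) ∧
      (∀ i, τ • i ≠ i → (σ * τ) • i ≠ i →
        b.equivFun (pairNorm ρ τ w) i = b.equivFun v i) ∧
      ∀ i, τ • i = i ∨ (σ * τ) • i = i → b.equivFun (pairNorm ρ τ w) i = 0 := by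
  let _ : LinearOrder ι := LinearOrder.lift' (Fintype.equivFin ι) (Fintype.equivFin ι).injective
  have hs (i : ι) : σ • σ • i = i := by rw [smul_smul, mul_self, one_smul]
  have ht (i : ι) : τ • τ • i = i := by rw [smul_smul, mul_self, one_smul]
  have hst (i : ι) : τ • σ • i = σ • τ • i := by rw [smul_smul, smul_smul, mul_comm]
  have hvs (i : ι) : b.equivFun v (σ • i) = b.equivFun v i := by rw [← coord_rho hb, hσ]
  have hvt (i : ι) : b.equivFun v (τ • i) = b.equivFun v i := by rw [← coord_rho hb, hτ]
  -- comparing minima selects one of the two `σ`-orbits in each orbit of the group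
  let c : ι → k := fun i =>
    if min i (σ • i) < min (τ • i) (σ • τ • i) then b.equivFun v i else 0
  have hc : ∀ i, c i + c (τ • i) =
      if min i (σ • i) = min (τ • i) (σ • τ • i) then 0 else b.equivFun v i := by
    intro i
    simp only [c, ht, hvt]
    rcases lt_trichotomy (min i (σ • i)) (min (τ • i) (σ • τ • i)) with h | h | h
    · rw [if_pos h, if_neg h.not_gt, if_neg h.ne, add_zero]
    · rw [if_neg h.not_lt, if_neg h.not_gt, if_pos h, add_zero]
    · rw [if_neg h.not_gt, if_pos h, if_neg h.ne', zero_add]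
  refine ⟨b.equivFun.symm c, ?_, ?_, ?_, ?_⟩
  · apply b.equivFun.injective
    ext i
    rw [coord_rho hb, LinearEquiv.apply_symm_apply]
    simp only [c, hs, hst, hvs, min_comm (σ • i), min_comm (σ • τ • i)]
  · intro i hi
    rw [LinearEquiv.apply_symm_apply]
    simp only [c, hi, ite_self]
  · intro i h1 h2
    rw [coord_pairNorm hb, LinearEquiv.apply_symm_apply, hc, if_neg]
    intro h
    rw [mul_smul] at h2
    have h3 : σ • τ • i ≠ σ • i := fun e => h1 (smul_left_cancel σ e)
    have h4 : τ • i ≠ σ • i := fun e => h2 (by rw [e, hs])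
    rcases min_choice i (σ • i) with e1 | e1 <;>
      rcases min_choice (τ • i) (σ • τ • i) with e2 | e2 <;> rw [e1, e2] at h
    exacts [h1 h.symm, h2 h.symm, h4 h.symm, h3 h.symm]
  · intro i h
    rw [coord_pairNorm hb, LinearEquiv.apply_symm_apply, hc, if_pos]
    rcases h with h | h
    · rw [h]
    · rw [mul_smul] at h
      have : τ • i = σ • i := by
        have := congrArg (σ • ·) h
        simpa [hs] using this
      rw [this, hs, min_comm]

/-- In a permutation module, an invariant vector without components at fixed basis vectors is a
sum of traces from the three subgroups of order two. -/
theorem exists_sum_of_traces (hb : ∀ (g : KleinFour) i, ρ g (b i) = b (g • i)) {v : V}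
    (hσ : ρ σ v = v) (hτ : ρ τ v = v)
    (h0 : ∀ i, σ • i = i → τ • i = i → b.equivFun v i = 0) :
    ∃ w₁ w₂ w₃, ρ σ w₁ = w₁ ∧ ρ τ w₂ = w₂ ∧ ρ (σ * τ) w₃ = w₃ ∧
      v = pairNorm ρ τ w₁ + pairNorm ρ σ w₂ + pairNorm ρ σ w₃ := by
  obtain ⟨w₁, hw, -, hw1, hw2⟩ := exists_pairNorm_τ_eq hb hσ hτ
  let _ : LinearOrder ι := LinearOrder.lift' (Fintype.equivFin ι) (Fintype.equivFin ι).injective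
  have hvs (i : ι) : b.equivFun v (σ • i) = b.equivFun v i := by rw [← coord_rho hb, hσ]
  have hfix : ∀ h : KleinFour, ∃ w, ρ h w = w ∧ ∀ i, b.equivFun (pairNorm ρ σ w) i =
      if h • i = i ∧ σ • i ≠ i then b.equivFun v i else 0 := by
    intro h
    have hhh (i : ι) : h • h • i = i := by rw [smul_smul, mul_self, one_smul]
    have hss (i : ι) : σ • σ • i = i := by rw [smul_smul, mul_self, one_smul]
    refine ⟨b.equivFun.symm fun i => if h • i = i ∧ i < σ • i then b.equivFun v i else 0,
      ?_, ?_⟩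
    · apply b.equivFun.injective
      ext i
      rw [coord_rho hb, LinearEquiv.apply_symm_apply]
      by_cases hi : h • i = i
      · simp [hi]
      · simp [hi, hhh, Ne.symm hi]
    · intro i
      rw [coord_pairNorm hb, LinearEquiv.apply_symm_apply]
      have e1 : h • σ • i = σ • i ↔ h • i = i := by
        rw [smul_smul, mul_comm, mul_smul]
        exact ⟨fun e => smul_left_cancel σ e, fun e => by rw [e]⟩
      simp only [e1, hss, hvs]
      by_cases hi : h • i = i
      · rcases lt_trichotomy i (σ • i) with h' | h' | h'
        · simp [hi, h', h'.not_gt, h'.ne']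
        · simp [hi, h'.symm]
        · simp [hi, h', h'.not_gt, h'.ne]
      · simp [hi]
  obtain ⟨w₂, h2, h2'⟩ := hfix τ
  obtain ⟨w₃, h3, h3'⟩ := hfix (σ * τ)
  refine ⟨w₁, w₂, w₃, hw, h2, h3, ?_⟩
  apply b.equivFun.injective
  ext i
  rw [map_add, map_add, Pi.add_apply, Pi.add_apply, h2', h3']
  by_cases ht : τ • i = i
  · rw [hw2 i (Or.inl ht)]
    by_cases hs : σ • i = i
    · rw [h0 i hs ht]; simp
    · have : (σ * τ) • i ≠ i := by rwa [mul_smul, ht]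
      simp [ht, hs, this]
  · by_cases hst : (σ * τ) • i = i
    · rw [hw2 i (Or.inr hst)]
      have hs : σ • i ≠ i := by
        intro hs
        rw [mul_comm, mul_smul, hs] at hst
        exact ht hst
      simp [ht, hs, hst]
    · rw [hw1 i ht hst]
      simp [ht, hst]

variable [CharP k 2]

/-- In a permutation module the images of the three norms of order two meet in the image of the
full norm, as can be checked on each orbit. -/
theorem mem_range_fullNorm (hb : ∀ (g : KleinFour) i, ρ g (b i) = b (g • i)) {v : V}
    (h : ∀ g : KleinFour, g ≠ 1 → v ∈ LinearMap.range (pairNorm ρ g)) :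
    v ∈ LinearMap.range (fullNorm ρ) := by
  have hinv : ∀ g : KleinFour, g ≠ 1 → ρ g v = v := by
    intro g hg
    obtain ⟨w, rfl⟩ := h g hg
    rw [← pairNorm_eq_zero_iff, pairNorm_pairNorm]
  have hzero : ∀ g : KleinFour, g ≠ 1 → ∀ i, g • i = i → b.equivFun v i = 0 := by
    intro g hg i hi
    obtain ⟨w, rfl⟩ := h g hg
    rw [coord_pairNorm hb, hi, CharTwo.add_self_eq_zero]
  obtain ⟨w, hw, hw0, hw1, hw2⟩ :=
    exists_pairNorm_τ_eq hb (hinv σ (by decide)) (hinv τ (by decide))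
  obtain ⟨w', rfl⟩ := mem_range_pairNorm hb hw
    fun i hi => hw0 i (hzero σ (by decide) i hi)
  refine ⟨w', ?_⟩
  apply b.equivFun.injective
  ext i
  rw [fullNorm_apply, pairNorm_comm]
  by_cases h1 : τ • i = i
  · rw [hw2 i (Or.inl h1), hzero τ (by decide) i h1]
  by_cases h2 : (σ * τ) • i = i
  · rw [hw2 i (Or.inr h2), hzero (σ * τ) (by decide) i h2]
  exact hw1 i h1 h2

end Lift

/-! ### Cokernels of injective maps between permutation modules -/

section Cokernel

variable {k P₁ P₀ E ι₁ ι₀ : Type*} [Field k]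
  [AddCommGroup P₁] [Module k P₁] [AddCommGroup P₀] [Module k P₀] [AddCommGroup E] [Module k E]
  [Fintype ι₁] [Fintype ι₀] [MulAction KleinFour ι₁] [MulAction KleinFour ι₀]
  {ρ₁ : Representation k KleinFour P₁} {ρ₀ : Representation k KleinFour P₀}
  {ρE : Representation k KleinFour E}
  {b₁ : Module.Basis ι₁ k P₁} {b₀ : Module.Basis ι₀ k P₀}
  {φ : ρ₁.IntertwiningMap ρ₀} {ε : ρ₀.IntertwiningMap ρE}

/-- If the restriction of the cokernel to `⟨g⟩` is free, then a `g`-invariant lift can be corrected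
by a norm so as to come from the submodule. -/
theorem exists_eq_pairNorm_add (hexact : Function.Exact φ ε) (hε : Function.Surjective ε)
    {g : KleinFour} (hE : ∀ e, ρE g e = e → e ∈ LinearMap.range (pairNorm ρE g)) {w : P₀}
    (hw : ρE g (ε w) = ε w) : ∃ w' u, w = pairNorm ρ₀ g w' + φ u := by
  obtain ⟨e, he⟩ := hE _ hw
  obtain ⟨w', rfl⟩ := hε e
  obtain ⟨u, hu⟩ := (hexact (w - pairNorm ρ₀ g w')).1 (by rw [map_sub, map_pairNorm, he, sub_self])
  exact ⟨w', u, by rw [hu]; abel⟩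

variable [CharP k 2]

theorem mem_range_pairNorm_of_map (hφ : Function.Injective φ) (hexact : Function.Exact φ ε)
    (hε : Function.Surjective ε) {g : KleinFour}
    (hE : ∀ e, ρE g e = e → e ∈ LinearMap.range (pairNorm ρE g)) {v : P₁}
    (hv : φ v ∈ LinearMap.range (pairNorm ρ₀ g)) : v ∈ LinearMap.range (pairNorm ρ₁ g) := by
  obtain ⟨w, hw⟩ := hv
  have h1 : ρE g (ε w) = ε w := by
    rw [← pairNorm_eq_zero_iff, ← map_pairNorm, hw]
    exact hexact.apply_apply_eq_zero v
  obtain ⟨w', u, rfl⟩ := exists_eq_pairNorm_add hexact hε hE h1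
  refine ⟨u, hφ ?_⟩
  rw [map_pairNorm, ← hw, map_add, pairNorm_pairNorm, zero_add]

theorem finrank_range_pairNorm_eq_add [Module.Finite k P₀] (hφ : Function.Injective φ)
    (hexact : Function.Exact φ ε) (hε : Function.Surjective ε) {g : KleinFour}
    (hE : ∀ e, ρE g e = e → e ∈ LinearMap.range (pairNorm ρE g)) :
    Module.finrank k (LinearMap.range (pairNorm ρ₀ g)) =
      Module.finrank k (LinearMap.range (pairNorm ρ₁ g)) +
        Module.finrank k (LinearMap.range (pairNorm ρE g)) := by
  let N := LinearMap.range (pairNorm ρ₀ g)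
  let f : LinearMap.range (pairNorm ρ₁ g) →ₗ[k] N :=
    (φ.toLinearMap ∘ₗ Submodule.subtype _).codRestrict N (by
      rintro ⟨_, v, rfl⟩
      exact ⟨φ v, (map_pairNorm φ g v).symm⟩)
  let h : N →ₗ[k] LinearMap.range (pairNorm ρE g) :=
    (ε.toLinearMap ∘ₗ Submodule.subtype _).codRestrict _ (by
      rintro ⟨_, v, rfl⟩
      exact ⟨ε v, (map_pairNorm ε g v).symm⟩)
  have hf : Function.Injective f := fun x y hxy =>
    Subtype.ext (hφ (congrArg Subtype.val hxy))
  have hh : LinearMap.range h = ⊤ := by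
    rw [LinearMap.range_eq_top]
    rintro ⟨_, e, rfl⟩
    obtain ⟨w, rfl⟩ := hε e
    exact ⟨⟨_, w, rfl⟩, Subtype.ext (map_pairNorm ε g w)⟩
  have hfh : LinearMap.ker h = LinearMap.range f := by
    ext ⟨x, hx⟩
    rw [LinearMap.mem_ker]
    constructor
    · intro h0
      obtain ⟨v, rfl⟩ := (hexact x).1 (congrArg Subtype.val h0)
      exact ⟨⟨v, mem_range_pairNorm_of_map hφ hexact hε hE hx⟩, rfl⟩
    · rintro ⟨⟨v, hv⟩, hv'⟩
      have : φ v = x := congrArg Subtype.val hv'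
      subst this
      exact Subtype.ext (hexact.apply_apply_eq_zero v)
  have := LinearMap.finrank_range_add_finrank_ker h
  rw [hh, finrank_top, hfh, LinearMap.finrank_range_of_inj hf] at this
  exact (this.symm.trans (add_comm _ _))

theorem range_fullNorm_le_map (hb₁ : ∀ (g : KleinFour) i, ρ₁ g (b₁ i) = b₁ (g • i))
    (hφ : Function.Injective φ) (hexact : Function.Exact φ ε) (hε : Function.Surjective ε)
    (hE : ∀ g : KleinFour, g ≠ 1 → ∀ e, ρE g e = e → e ∈ LinearMap.range (pairNorm ρE g))
    (hE0 : ∀ e, fullNorm ρE e = 0) :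
    LinearMap.range (fullNorm ρ₀) ≤ (LinearMap.range (fullNorm ρ₁)).map φ.toLinearMap := by
  rintro _ ⟨w, rfl⟩
  obtain ⟨v, hv⟩ := (hexact (fullNorm ρ₀ w)).1 (by rw [map_fullNorm, hE0])
  refine ⟨v, mem_range_fullNorm hb₁ fun g hg =>
    mem_range_pairNorm_of_map hφ hexact hε (hE g hg) ?_, hv⟩
  rw [hv]
  rcases eq_or g with rfl | rfl | rfl | rfl
  · exact absurd rfl hg
  · exact ⟨_, rfl⟩
  · exact ⟨pairNorm ρ₀ σ w, pairNorm_comm _ _ _⟩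
  · exact ⟨_, (fullNorm_eq_pairNorm_στ w).symm⟩

theorem coord_pairNorm_eq_zero (hb₁ : ∀ (g : KleinFour) i, ρ₁ g (b₁ i) = b₁ (g • i))
    {g : KleinFour} {i : ι₁} (hi : g • i = i) (v : P₁) :
    b₁.equivFun (pairNorm ρ₁ g v) i = 0 := by
  rw [coord_pairNorm hb₁, hi, CharTwo.add_self_eq_zero]

/-- The map induced by `φ` on the spans of the fixed basis vectors is injective. This is the
injectivity of `φ` on the quotient of the invariants by all traces from proper subgroups, a
quotient that has the fixed basis vectors as a basis. -/
theorem card_fixed_le [DecidableEq ι₁] [DecidableEq ι₀]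
    (hb₁ : ∀ (g : KleinFour) i, ρ₁ g (b₁ i) = b₁ (g • i))
    (hb₀ : ∀ (g : KleinFour) i, ρ₀ g (b₀ i) = b₀ (g • i))
    (hφ : Function.Injective φ) (hexact : Function.Exact φ ε) (hε : Function.Surjective ε)
    (hE : ∀ g : KleinFour, g ≠ 1 → ∀ e, ρE g e = e → e ∈ LinearMap.range (pairNorm ρE g))
    (hE0 : ∀ e, fullNorm ρE e = 0) :
    (Finset.univ.filter fun i : ι₁ => σ • i = i ∧ τ • i = i).card ≤
      (Finset.univ.filter fun i : ι₀ => σ • i = i ∧ τ • i = i).card := by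
  let F₁ := Finset.univ.filter fun i : ι₁ => σ • i = i ∧ τ • i = i
  let F₀ := Finset.univ.filter fun i : ι₀ => σ • i = i ∧ τ • i = i
  let incl : (F₁ → k) →ₗ[k] P₁ := Fintype.linearCombination k fun i : F₁ => b₁ i
  let proj : P₀ →ₗ[k] (F₀ → k) :=
    LinearMap.funLeft k k (fun i : F₀ => (i : ι₀)) ∘ₗ b₀.equivFun.toLinearMap
  have hF₁ (i : F₁) : σ • (i : ι₁) = i ∧ τ • (i : ι₁) = i := (Finset.mem_filter.1 i.2).2
  have hincl : ∀ f (i : F₁), b₁.equivFun (incl f) i = f i := by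
    intro f i
    simp only [incl, Fintype.linearCombination_apply, map_sum, map_smul, Finset.sum_apply,
      Pi.smul_apply, Module.Basis.equivFun_self, smul_eq_mul, mul_ite, mul_one, mul_zero,
      Subtype.coe_inj, Finset.sum_ite_eq', Finset.mem_univ, if_true]
  have hσ : ∀ f, ρ₁ σ (incl f) = incl f := fun f => by
    simp only [incl, Fintype.linearCombination_apply, map_sum, map_smul, hb₁, (hF₁ _).1]
  have hτ : ∀ f, ρ₁ τ (incl f) = incl f := fun f => by
    simp only [incl, Fintype.linearCombination_apply, map_sum, map_smul, hb₁, (hF₁ _).2]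
  have hinj : Function.Injective (proj ∘ₗ φ.toLinearMap ∘ₗ incl) := by
    rw [injective_iff_map_eq_zero]
    intro f hf
    have h0 : ∀ i, σ • i = i → τ • i = i → b₀.equivFun (φ (incl f)) i = 0 := fun i h1 h2 =>
      congrFun hf ⟨i, Finset.mem_filter.2 ⟨Finset.mem_univ _, h1, h2⟩⟩
    obtain ⟨w₁, w₂, w₃, h1, h2, h3, hsum⟩ := exists_sum_of_traces hb₀
      (by rw [← φ.isIntertwining, hσ]) (by rw [← φ.isIntertwining, hτ]) h0
    obtain ⟨w₁', u₁, rfl⟩ := exists_eq_pairNorm_add hexact hε (hE σ (by decide))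
      (w := w₁) (by rw [← ε.isIntertwining, h1])
    obtain ⟨w₂', u₂, rfl⟩ := exists_eq_pairNorm_add hexact hε (hE τ (by decide))
      (w := w₂) (by rw [← ε.isIntertwining, h2])
    obtain ⟨w₃', u₃, rfl⟩ := exists_eq_pairNorm_add hexact hε (hE (σ * τ) (by decide))
      (w := w₃) (by rw [← ε.isIntertwining, h3])
    obtain ⟨_, ⟨x, rfl⟩, hx⟩ :=
      range_fullNorm_le_map hb₁ hφ hexact hε hE hE0 ⟨w₁' + w₂' + w₃', rfl⟩
    have hv : incl f = pairNorm ρ₁ τ u₁ + pairNorm ρ₁ σ (u₂ + u₃) + fullNorm ρ₁ x := by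
      apply hφ
      have hx' : φ (fullNorm ρ₁ x) = fullNorm ρ₀ (w₁' + w₂' + w₃') := hx
      rw [map_add φ, map_add φ, map_pairNorm, map_pairNorm, hx', hsum]
      have e1 : pairNorm ρ₀ τ (pairNorm ρ₀ σ w₁') = fullNorm ρ₀ w₁' := pairNorm_comm _ _ _
      have e2 : pairNorm ρ₀ σ (pairNorm ρ₀ τ w₂') = fullNorm ρ₀ w₂' := rfl
      have e3 : pairNorm ρ₀ σ (pairNorm ρ₀ (σ * τ) w₃') = fullNorm ρ₀ w₃' := by
        rw [fullNorm_eq_pairNorm_στ, pairNorm_comm]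
      simp only [map_add, e1, e2, e3]
      abel
    ext i
    rw [← hincl f i, hv, fullNorm_apply, map_add, map_add, Pi.add_apply, Pi.add_apply,
      coord_pairNorm_eq_zero hb₁ (hF₁ i).1, coord_pairNorm_eq_zero hb₁ (hF₁ i).1,
      coord_pairNorm_eq_zero hb₁ (hF₁ i).2]
    simp
  have := LinearMap.finrank_le_finrank_of_injective hinj
  rw [Module.finrank_fintype_fun_eq_card, Module.finrank_fintype_fun_eq_card, Fintype.card_coe,
    Fintype.card_coe] at this
  exact this

/-- A nonzero module that is free over each subgroup of order two, and killed by the norm of the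
whole group, is not the cokernel of an injective map between permutation modules. -/
theorem not_exact_of_permutation (hb₁ : ∀ (g : KleinFour) i, ρ₁ g (b₁ i) = b₁ (g • i))
    (hb₀ : ∀ (g : KleinFour) i, ρ₀ g (b₀ i) = b₀ (g • i))
    (hφ : Function.Injective φ) (hε : Function.Surjective ε) [Nontrivial E]
    (hE : ∀ g : KleinFour, g ≠ 1 → ∀ e, ρE g e = e → e ∈ LinearMap.range (pairNorm ρE g))
    (hE0 : ∀ e, fullNorm ρE e = 0) : ¬ Function.Exact φ ε := by
  classical
  intro hexact
  have : Module.Finite k P₁ := Module.Finite.of_basis b₁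
  have : Module.Finite k P₀ := Module.Finite.of_basis b₀
  have : Module.Finite k E := Module.Finite.of_surjective ε.toLinearMap hε
  have hrE : ∀ g : KleinFour, g ≠ 1 →
      2 * Module.finrank k (LinearMap.range (pairNorm ρE g)) = Module.finrank k E := by
    intro g hg
    have hker : LinearMap.ker (pairNorm ρE g) = LinearMap.range (pairNorm ρE g) := by
      ext e
      rw [LinearMap.mem_ker, pairNorm_eq_zero_iff]
      refine ⟨hE g hg e, ?_⟩
      rintro ⟨e', rfl⟩
      rw [← pairNorm_eq_zero_iff, pairNorm_pairNorm]
    rw [← LinearMap.finrank_range_add_finrank_ker (pairNorm ρE g), hker, two_mul]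
  have hr : ∀ g : KleinFour, g ≠ 1 → _ := fun g hg =>
    finrank_range_pairNorm_eq_add hφ hexact hε (hE g hg)
  have hdim : Module.finrank k P₀ = Module.finrank k P₁ + Module.finrank k E := by
    have hker : LinearMap.ker ε.toLinearMap = LinearMap.range φ.toLinearMap :=
      LinearMap.exact_iff.1 hexact
    have hrange : LinearMap.range ε.toLinearMap = ⊤ := LinearMap.range_eq_top.2 hε
    have := LinearMap.finrank_range_add_finrank_ker ε.toLinearMap
    rw [hker, hrange, finrank_top, LinearMap.finrank_range_of_inj (f := φ.toLinearMap) hφ] at this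
    omega
  have hd : Module.finrank k (LinearMap.range (fullNorm ρ₀)) ≤
      Module.finrank k (LinearMap.range (fullNorm ρ₁)) :=
    (Submodule.finrank_mono (range_fullNorm_le_map hb₁ hφ hexact hε hE hE0)).trans
      (Submodule.finrank_map_le _ _)
  have hc := card_fixed_le hb₁ hb₀ hφ hexact hε hE hE0
  have h1 := finrank_add_two_mul_finrank_range_fullNorm hb₁
  have h0 := finrank_add_two_mul_finrank_range_fullNorm hb₀
  have hpos : 0 < Module.finrank k E := Module.finrank_pos
  have r1 := hr σ (by decide)
  have r2 := hr τ (by decide)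
  have r3 := hr (σ * τ) (by decide)
  have s1 := hrE σ (by decide)
  have s2 := hrE τ (by decide)
  have s3 := hrE (σ * τ) (by decide)
  omega

end Cokernel

/-- A basis permuted by the group gives an action of the group on the index set. -/
theorem exists_mulAction_of_isPermutation {k : Type u} [Field k] {M : Rep.{w} k KleinFour}
    (hM : IsPermutation M) :
    ∃ (ι : Type w) (_ : Fintype ι) (_ : MulAction KleinFour ι) (b : Module.Basis ι k M),
      ∀ (g : KleinFour) i, M.ρ g (b i) = b (g • i) := by
  obtain ⟨hfin, ι, b, h⟩ := hM
  choose act hact using h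
  have : Fintype ι := @Fintype.ofFinite ι (Module.Finite.finite_basis b)
  exact ⟨ι, this,
    { smul := act
      one_smul := fun i => b.injective ((hact 1 i).symm.trans (by rw [map_one]; rfl))
      mul_smul := fun g h i => b.injective ((hact (g * h) i).symm.trans (by
        rw [map_mul, Module.End.mul_apply, hact h i, hact g]; rfl)) }, b, hact⟩

end KleinFour

/-! ### Bounds on the `p`-permutation dimension -/

section Bounds

variable {k : Type u} {G : Type v} [Field k] [Group G] {p : ℕ} {M : Rep.{w} k G}

theorem isPPermutation_of_subsingleton (A : Rep.{w} k G) [Subsingleton A] :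
    IsPPermutation p A :=
  ⟨inferInstance, default, PEmpty, Module.Basis.empty A, fun _ _ i => i.elim⟩

theorem ppdim_le_two {A₂ A₁ A₀ : Rep.{w} k G} (h₂ : IsPPermutation p A₂)
    (h₁ : IsPPermutation p A₁) (h₀ : IsPPermutation p A₀) (d₁ : A₂ ⟶ A₁) (d₀ : A₁ ⟶ A₀)
    (ε : A₀ ⟶ M) (hd₁ : Function.Injective d₁.hom) (h₁₀ : Function.Exact d₁.hom d₀.hom)
    (h₀ε : Function.Exact d₀.hom ε.hom) (hε : Function.Surjective ε.hom) : ppdim p M ≤ 2 := by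
  let Z : Rep.{w} k G := Rep.of (Representation.trivial k G PUnit.{w + 1})
  have hZ : Subsingleton Z := inferInstanceAs (Subsingleton PUnit.{w + 1})
  let X : ℕ → Rep.{w} k G
    | 0 => A₀
    | 1 => A₁
    | 2 => A₂
    | _ + 3 => Z
  let d : ∀ i, X (i + 1) ⟶ X i
    | 0 => d₀
    | 1 => d₁
    | _ + 2 => 0
  let R : PPermResolution p M :=
    { X := X
      d := d
      ε := ε
      isPPermutation := by
        rintro (_ | _ | _ | i)
        exacts [h₀, h₁, h₂, isPPermutation_of_subsingleton Z]
      exact_succ := by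
        rintro (_ | _ | i)
        · exact h₁₀
        · intro x
          constructor
          · intro hx
            exact ⟨0, (map_zero _).trans (hd₁ (hx.trans (map_zero d₁.hom).symm)).symm⟩
          · rintro ⟨y, rfl⟩
            exact map_zero d₁.hom
        · intro x
          exact ⟨fun _ => ⟨0, Subsingleton.elim (α := Z) _ _⟩, fun _ => rfl⟩
      exact_zero := h₀ε
      surjective := hε }
  refine (iInf_le _ R).trans (iSup₂_le ?_)
  rintro (_ | _ | _ | i) hi
  · exact zero_le
  · exact Nat.cast_le.2 one_le_two
  · exact le_rfl
  · exact absurd hi (not_nontrivial Z)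

theorem two_le_ppdim (h : ∀ (A₁ A₀ : Rep.{w} k G) (d : A₁ ⟶ A₀) (ε : A₀ ⟶ M),
    IsPPermutation p A₁ → IsPPermutation p A₀ → Function.Injective d.hom →
      Function.Surjective ε.hom → ¬ Function.Exact d.hom ε.hom) : 2 ≤ ppdim p M := by
  refine le_iInf fun R => ?_
  by_cases h2 : Nontrivial (R.X 2)
  · exact le_iSup₂_of_le (f := fun (i : ℕ) (_ : Nontrivial (R.X i)) => (i : ℕ∞)) 2 h2 le_rfl
  · rw [not_nontrivial_iff_subsingleton] at h2
    refine absurd R.exact_zero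
      (h _ _ _ _ (R.isPPermutation 1) (R.isPPermutation 0) ?_ R.surjective)
    rw [injective_iff_map_eq_zero]
    intro x hx
    obtain ⟨y, rfl⟩ := (R.exact_succ 0 x).1 hx
    rw [Subsingleton.elim y 0, map_zero]

end Bounds

namespace KleinFour

theorem isPGroup : IsPGroup 2 KleinFour :=
  IsPGroup.of_card (n := 2) (by rw [Nat.card_eq_fintype_card]; decide)

/-! ### Permutation modules of functions -/

section FunRep

variable (k U Y : Type*) [Field k] [AddCommGroup U] [Module k U] [MulAction KleinFour Y]

/-- The functions on a set with an action of the Klein four-group, with values in a vector space,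
as a representation by translation: a direct sum of copies of the permutation module on `Y`. -/
def funRep : Representation k KleinFour (Y → U) where
  toFun g := LinearMap.funLeft k U fun y => g⁻¹ • y
  map_one' := by ext; simp [LinearMap.funLeft_apply]
  map_mul' g h := by
    ext f y
    simp [LinearMap.funLeft_apply, smul_smul, mul_comm h⁻¹ g⁻¹]

variable {k U Y}

theorem funRep_apply (g : KleinFour) (f : Y → U) (y : Y) :
    funRep k U Y g f y = f (g⁻¹ • y) := rfl

end FunRep

theorem isPermutation_funRep {k : Type u} [Field k] {Y : Type} [Finite Y] [MulAction KleinFour Y]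
    (m : ℕ) : IsPermutation (Rep.of (funRep k (Fin m → k) Y)) := by
  classical
  have := Fintype.ofFinite Y
  let b := (Pi.basis fun _ : Y => Pi.basisFun k (Fin m)).reindex Equiv.ulift.{u}.symm
  refine ⟨inferInstanceAs (Module.Finite k (Y → Fin m → k)), _, b, ?_⟩
  rintro g ⟨y, i⟩
  refine ⟨⟨g • y, i⟩, ?_⟩
  have hb : ∀ z, b ⟨z, i⟩ = Pi.single z (Pi.single i 1) := fun z => by
    simp [b, Pi.basis_apply]
  rw [hb, hb]
  ext z : 1
  change (Pi.single y (Pi.single i 1) : Y → Fin m → k) (g⁻¹ • z) = _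
  by_cases hz : z = g • y
  · subst hz
    rw [inv_smul_smul, Pi.single_eq_same, Pi.single_eq_same]
  · rw [Pi.single_eq_of_ne hz, Pi.single_eq_of_ne]
    rintro rfl
    exact hz (smul_inv_smul _ _).symm

/-- The disjoint union of the coset spaces of `⟨σ⟩` and `⟨τ⟩`. A coset of `⟨σ⟩` is given by its
`τ`-exponent, and a coset of `⟨τ⟩` by its `σ`-exponent. -/
inductive Cosets : Type
  | modσ (c : ZMod 2)
  | modτ (c : ZMod 2)

instance : Finite Cosets :=
  Finite.of_surjective (Sum.elim Cosets.modσ Cosets.modτ) (by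
    rintro (c | c)
    exacts [⟨Sum.inl c, rfl⟩, ⟨Sum.inr c, rfl⟩])

instance : MulAction KleinFour Cosets where
  smul
    | g, .modσ c => .modσ (g.toAdd.2 + c)
    | g, .modτ c => .modτ (g.toAdd.1 + c)
  one_smul
    | .modσ c => congrArg Cosets.modσ (zero_add c)
    | .modτ c => congrArg Cosets.modτ (zero_add c)
  mul_smul
    | _, _, .modσ _ => congrArg Cosets.modσ (add_assoc _ _ _)
    | _, _, .modτ _ => congrArg Cosets.modτ (add_assoc _ _ _)

theorem sum_kleinFour {A : Type*} [AddCommMonoid A] (F : KleinFour → A) :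
    ∑ g, F g = F 1 + F σ + F τ + F (σ * τ) := by
  have h : (Finset.univ : Finset KleinFour) = {1, σ, τ, σ * τ} := by decide
  rw [h, Finset.sum_insert (by decide), Finset.sum_insert (by decide),
    Finset.sum_insert (by decide), Finset.sum_singleton, add_assoc, add_assoc]

end KleinFour

/-! ### The structure of `E_{f,n}` -/

namespace EModule

open KleinFour

section Structure

variable {k : Type u} [Field k] (q : k[X])

/-- The map `T` with `b u = T a u`: multiplication by `t` on `k[t] / (q)`. -/
noncomputable def shift : Module.End k (Fin q.natDegree → k) :=
  Fintype.linearCombination k (bImage q)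

variable [CharP k 2]

/-- The representation `E` attached to a polynomial `q`, so that `E_{f,n}` is the case
`q = f ^ n`. -/
noncomputable def rho :
    Representation k KleinFour ((Fin q.natDegree → k) × (Fin q.natDegree → k)) :=
  KleinFour.rep (EModule.a k q.natDegree) (EModule.b q)
    (EModule.a_mul_a _) (EModule.b_mul_b _) (EModule.commute_a_b _)

variable {q}

theorem rho_σ (x : (Fin q.natDegree → k) × (Fin q.natDegree → k)) :
    rho q σ x = (x.1, x.2 + x.1) := by
  rw [rho, rep_σ]
  ext <;> simp [a]

theorem rho_τ (x : (Fin q.natDegree → k) × (Fin q.natDegree → k)) :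
    rho q τ x = (x.1, x.2 + shift q x.1) := by
  rw [rho, rep_τ]
  ext <;> simp [b, shift]

theorem rho_στ (x : (Fin q.natDegree → k) × (Fin q.natDegree → k)) :
    rho q (σ * τ) x = (x.1, x.2 + (x.1 + shift q x.1)) := by
  rw [← rho_mul_apply, rho_τ, rho_σ, add_assoc, add_comm (shift q x.1)]

theorem rho_inr (g : KleinFour) (v : Fin q.natDegree → k) : rho q g (0, v) = (0, v) := by
  rcases KleinFour.eq_or g with rfl | rfl | rfl | rfl
  · rw [map_one]; rfl
  · simp [rho_σ]
  · simp [rho_τ]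
  · rw [rho_στ]; simp

theorem fullNorm_rho (x : (Fin q.natDegree → k) × (Fin q.natDegree → k)) :
    fullNorm (rho q) x = 0 := by
  have h : ∀ y : Fin q.natDegree → k, y + y = 0 := add_self_eq_zero k
  ext1
  · simp [fullNorm_apply, pairNorm_apply, rho_σ, rho_τ, h]
  · simp only [fullNorm_apply, pairNorm_apply, rho_σ, rho_τ, Prod.snd_add, Prod.fst_add, h]
    simp [← add_assoc, h]

/-- The reduction of `t ^ (i + 1)` modulo `q`, evaluated at `c`: it differs from `c ^ (i + 1)` only
for the top power, where reducing subtracts `q`. -/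
theorem sum_bImage_mul_pow (hq : q.Monic) (c : k) (i : Fin q.natDegree) :
    ∑ j, bImage q i j * c ^ (j : ℕ) =
      c ^ ((i : ℕ) + 1) + if (i : ℕ) + 1 < q.natDegree then 0 else q.eval c := by
  by_cases h : (i : ℕ) + 1 < q.natDegree
  · rw [if_pos h, add_zero, Finset.sum_eq_single ⟨i + 1, h⟩]
    · simp [bImage, h]
    · intro j _ hj
      simp [bImage, h, Pi.single_eq_of_ne hj]
    · simp
  · have hi : (i : ℕ) + 1 = q.natDegree := by omega
    rw [if_neg h, eval_eq_sum_range, Finset.sum_range_succ, hq.coeff_natDegree, one_mul, hi,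
      add_left_comm, CharTwo.add_self_eq_zero, add_zero, ← Fin.sum_univ_eq_sum_range
        (fun j => q.coeff j * c ^ j)]
    simp [bImage, hi]

/-- The eigenvalues of multiplication by `t` on `k[t] / (q)` are roots of `q`. -/
theorem eq_zero_of_shift_eq_smul (hq : q.Monic) {c : k} (hc : q.eval c ≠ 0)
    {u : Fin q.natDegree → k} (hu : shift q u = c • u) : u = 0 := by
  have hcoord : ∀ j, ∑ i, u i * bImage q i j = c * u j := by
    intro j
    simpa [shift, Fintype.linearCombination_apply] using congrFun hu j
  -- evaluating `t u = c u` at `t = c` kills the top coefficient of `u`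
  have htop : ∀ i : Fin q.natDegree, (i : ℕ) + 1 = q.natDegree → u i = 0 := by
    intro i hi
    have h1 : ∑ j, (∑ l, u l * bImage q l j) * c ^ (j : ℕ) = ∑ j, (c * u j) * c ^ (j : ℕ) :=
      Finset.sum_congr rfl fun j _ => by rw [hcoord]
    simp only [Finset.sum_mul] at h1
    rw [Finset.sum_comm] at h1
    have h2 : ∀ l : Fin q.natDegree, ∑ j, u l * bImage q l j * c ^ (j : ℕ) =
        c * u l * c ^ (l : ℕ) + if l = i then u i * q.eval c else 0 := by
      intro l
      simp only [mul_assoc]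
      rw [← Finset.mul_sum, sum_bImage_mul_pow hq]
      by_cases hl : l = i
      · subst hl
        rw [if_neg (by omega), if_pos rfl]
        ring
      · have : (l : ℕ) ≠ i := fun e => hl (Fin.ext e)
        rw [if_pos (by omega), if_neg hl]
        ring
    rw [Finset.sum_congr rfl fun l _ => h2 l, Finset.sum_add_distrib, add_eq_left,
      Finset.sum_ite_eq' Finset.univ i, if_pos (Finset.mem_univ i)] at h1
    exact (mul_eq_zero.1 h1).resolve_right hc
  -- below the top, `t u = c u` determines each coefficient from the next higher one
  have hall : ∀ (r : ℕ) (i : Fin q.natDegree), (i : ℕ) + 1 + r = q.natDegree → u i = 0 := by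
    intro r
    induction r with
    | zero => exact fun i hi => htop i hi
    | succ r ih =>
      intro i hi
      have hlt : (i : ℕ) + 1 < q.natDegree := by omega
      have h1 := hcoord ⟨i + 1, hlt⟩
      rw [ih ⟨i + 1, hlt⟩ (by simp only; omega), mul_zero, Finset.sum_eq_single i] at h1
      · simpa [bImage, hlt] using h1
      · intro l _ hl
        by_cases h : (l : ℕ) + 1 < q.natDegree
        · have : (⟨i + 1, hlt⟩ : Fin q.natDegree) ≠ ⟨l + 1, h⟩ := fun e => hl (by
            have := congrArg Fin.val e
            exact Fin.ext (by simp only at this; omega))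
          simp [bImage, h, Pi.single_eq_of_ne this]
        · rw [htop l (by omega), zero_mul]
      · simp
  ext i
  exact hall (q.natDegree - (i + 1)) i (by omega)

/-- If neither `0` nor `1` is a root of `q`, the restrictions of `E` to the subgroups of order two
are free, as `t`, `1` and `t + 1` act invertibly on `k[t] / (q)`. -/
theorem mem_range_pairNorm_rho (hq : q.Monic) (h0 : q.eval 0 ≠ 0) (h1 : q.eval 1 ≠ 0)
    {g : KleinFour} (hg : g ≠ 1) (x : (Fin q.natDegree → k) × (Fin q.natDegree → k))
    (hx : rho q g x = x) : x ∈ LinearMap.range (pairNorm (rho q) g) := by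
  have key : ∀ S : Module.End k (Fin q.natDegree → k), (∀ u, S u = 0 → u = 0) →
      (∀ y, rho q g y = (y.1, y.2 + S y.1)) → x ∈ LinearMap.range (pairNorm (rho q) g) := by
    intro S hS hgS
    have hinj : Function.Injective S := (injective_iff_map_eq_zero S).2 hS
    have hx1 : x.1 = 0 := by
      rw [hgS] at hx
      exact hS _ (by simpa using congrArg Prod.snd hx)
    obtain ⟨u, hu⟩ := LinearMap.surjective_of_injective hinj x.2
    refine ⟨(u, 0), ?_⟩
    rw [pairNorm_apply, hgS]
    ext1
    · simp [hx1, add_self_eq_zero k]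
    · simp [hu]
  rcases KleinFour.eq_or g with rfl | rfl | rfl | rfl
  · exact absurd rfl hg
  · exact key 1 (fun u hu => hu) rho_σ
  · refine key (shift q) (fun u hu => eq_zero_of_shift_eq_smul hq h0 ?_) rho_τ
    rw [hu, zero_smul]
  · refine key (1 + shift q) (fun u hu => eq_zero_of_shift_eq_smul hq h1 ?_) rho_στ
    have hu' : u + shift q u = 0 := hu
    rw [one_smul, ← add_right_inj u, hu', add_self_eq_zero k]

end Structure

/-! ### A resolution of length two -/

section Resolution

variable {k : Type u} [Field k] (q : k[X])

/-- The map `(k[V₄/σ] ⊕ k[V₄/τ]) ⊗ U → k[V₄] ⊗ U ⊕ U` onto the kernel of the augmentation. It embeds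
functions on cosets into functions on the group; the component in `U` makes the composite with the
augmentation vanish. -/
noncomputable def syzygy :
    (funRep k (Fin q.natDegree → k) Cosets).IntertwiningMap
      (funRep k (Fin q.natDegree → k) (KleinFour ⊕ Unit)) :=
  LinearMap.intertwiningMap_of_isIntertwiningMap _ _
    { toFun := fun p => Sum.elim
        (fun g : KleinFour => p (.modσ g.toAdd.2) + p (.modτ g.toAdd.1))
        (fun _ => ∑ c, p (.modσ c) + shift q (∑ c, p (.modτ c)))
      map_add' := fun p p' => by
        ext1 (g | y)
        · simp only [Sum.elim_inl, Pi.add_apply]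
          abel
        · simp only [Sum.elim_inr, Pi.add_apply, Finset.sum_add_distrib, map_add]
          abel
      map_smul' := fun c p => by
        ext1 (g | y)
        · simp
        · simp [Finset.smul_sum] } (by
    intro h p
    ext1 (g | y)
    · rfl
    · refine congrArg₂ (· + ·) ?_ (congrArg (shift q) ?_)
      · exact Fintype.sum_equiv (Equiv.addLeft h⁻¹.toAdd.2) _ _ fun c => rfl
      · exact Fintype.sum_equiv (Equiv.addLeft h⁻¹.toAdd.1) _ _ fun c => rfl)

/-- The diagonal embedding of constant functions `U → (k[V₄/σ] ⊕ k[V₄/τ]) ⊗ U`. -/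
noncomputable def constants :
    (funRep k (Fin q.natDegree → k) Unit).IntertwiningMap
      (funRep k (Fin q.natDegree → k) Cosets) :=
  LinearMap.intertwiningMap_of_isIntertwiningMap _ _
    (LinearMap.pi fun _ => LinearMap.proj ()) (fun _ _ => rfl)

variable {q}

theorem syzygy_inl (p : Cosets → Fin q.natDegree → k) (g : KleinFour) :
    syzygy q p (Sum.inl g) = p (.modσ g.toAdd.2) + p (.modτ g.toAdd.1) := rfl

theorem syzygy_inr (p : Cosets → Fin q.natDegree → k) :
    syzygy q p (Sum.inr ()) =
      p (.modσ 0) + p (.modσ 1) + shift q (p (.modτ 0) + p (.modτ 1)) := by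
  change ∑ c, p (.modσ c) + shift q (∑ c, p (.modτ c)) = _
  have h : (Finset.univ : Finset (ZMod 2)) = {0, 1} := by decide
  rw [h, Finset.sum_pair (by decide), Finset.sum_pair (by decide)]

theorem injective_constants : Function.Injective (constants q) := fun _ _ h =>
  funext fun _ => congrFun h (.modσ 0)

variable [CharP k 2]

variable (q) in
/-- The map `k[V₄] ⊗ U ⊕ U → E`, where `U = k[t] / (q)`: the first summand covers `E` from its top
`U`, and the second one maps onto the socle. -/
noncomputable def augmentation :
    (funRep k (Fin q.natDegree → k) (KleinFour ⊕ Unit)).IntertwiningMap (rho q) :=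
  LinearMap.intertwiningMap_of_isIntertwiningMap _ _
    { toFun := fun w => ∑ g : KleinFour, rho q g (w (Sum.inl g), 0) + (0, w (Sum.inr ()))
      map_add' := fun w w' => by
        have h1 (x y : Fin q.natDegree → k) :
            ((x + y, 0) : (Fin q.natDegree → k) × (Fin q.natDegree → k)) = (x, 0) + (y, 0) := by
          simp
        have h2 (x y : Fin q.natDegree → k) :
            ((0, x + y) : (Fin q.natDegree → k) × (Fin q.natDegree → k)) = (0, x) + (0, y) := by
          simp
        simp only [Pi.add_apply, h1, h2, map_add, Finset.sum_add_distrib]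
        abel
      map_smul' := fun c w => by
        have h1 (x : Fin q.natDegree → k) :
            ((c • x, 0) : (Fin q.natDegree → k) × (Fin q.natDegree → k)) = c • (x, 0) := by
          simp
        have h2 (x : Fin q.natDegree → k) :
            ((0, c • x) : (Fin q.natDegree → k) × (Fin q.natDegree → k)) = c • (0, x) := by
          simp
        simp only [Pi.smul_apply, h1, h2, map_smul, ← Finset.smul_sum, ← smul_add]
        rfl } (by
    intro h w
    simp only [LinearMap.coe_mk, AddHom.coe_mk, map_add, map_sum, rho_mul_apply, rho_inr,
      funRep_apply]
    refine congrArg₂ (· + ·) ?_ rfl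
    refine Fintype.sum_equiv (Equiv.mulLeft h⁻¹) _ _ fun g => ?_
    simp)

theorem augmentation_apply (w : KleinFour ⊕ Unit → Fin q.natDegree → k) :
    augmentation q w =
      (w (Sum.inl 1) + w (Sum.inl σ) + w (Sum.inl τ) + w (Sum.inl (σ * τ)),
        w (Sum.inl σ) + shift q (w (Sum.inl τ)) +
          (w (Sum.inl (σ * τ)) + shift q (w (Sum.inl (σ * τ)))) + w (Sum.inr ())) := by
  change ∑ g : KleinFour, rho q g (w (Sum.inl g), 0) + (0, w (Sum.inr ())) = _
  rw [sum_kleinFour, rho_σ, rho_τ, rho_στ, map_one]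
  ext1 <;> simp

theorem surjective_augmentation : Function.Surjective (augmentation q) := by
  rintro ⟨u, v⟩
  refine ⟨Sum.elim (Pi.single 1 u) fun _ => v, ?_⟩
  have h1 : (σ : KleinFour) ≠ 1 := by decide
  have h2 : (τ : KleinFour) ≠ 1 := by decide
  have h3 : (σ * τ : KleinFour) ≠ 1 := by decide
  rw [augmentation_apply]
  simp [Pi.single_eq_of_ne h1, Pi.single_eq_of_ne h2, Pi.single_eq_of_ne h3]

variable (k) in
theorem add_eq_zero_iff_eq {V : Type*} [AddCommGroup V] [Module k V] {x y : V} :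
    x + y = 0 ↔ x = y := by
  rw [← add_left_inj y, add_assoc, add_self_eq_zero k y, add_zero, zero_add]

theorem exact_syzygy_augmentation : Function.Exact (syzygy q) (augmentation q) := by
  have hd : ∀ x : Fin q.natDegree → k, x + x = 0 := add_self_eq_zero k
  have hd' : ∀ x y : Fin q.natDegree → k, x + (x + y) = y := fun x y => by
    rw [← add_assoc, hd, zero_add]
  intro w
  constructor
  · intro hw
    rw [augmentation_apply, Prod.mk_eq_zero] at hw
    obtain ⟨h1, h2⟩ := hw
    have hst : w (Sum.inl (σ * τ)) = w (Sum.inl 1) + w (Sum.inl σ) + w (Sum.inl τ) :=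
      ((add_eq_zero_iff_eq k).1 h1).symm
    have hy := ((add_eq_zero_iff_eq k).1 h2).symm
    -- the coset functions are determined by `w` up to a common constant, fixed here by
    -- requiring the value `0` at the trivial coset of `⟨τ⟩`
    let p : Cosets → Fin q.natDegree → k
      | .modσ c => if c = 0 then w (Sum.inl 1) else w (Sum.inl τ)
      | .modτ c => if c = 0 then 0 else w (Sum.inl 1) + w (Sum.inl σ)
    refine ⟨p, ?_⟩
    ext1 y
    rcases y with g | y
    · rw [syzygy_inl]
      rcases KleinFour.eq_or g with rfl | rfl | rfl | rfl
      · simp [p]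
      · simp [p, σ, hd']
      · simp [p, τ]
      · rw [hst]
        simp [p, σ, τ]
        abel
    · obtain rfl : y = () := rfl
      rw [syzygy_inr, hy, hst]
      simp only [p, if_true, one_ne_zero, if_false, map_add, zero_add]
      ext j
      simp only [Pi.add_apply]
      linear_combination (-1 : k) * CharTwo.add_self_eq_zero (w (Sum.inl σ) j) -
        CharTwo.add_self_eq_zero (shift q (w (Sum.inl τ)) j)
  · rintro ⟨p, rfl⟩
    have e1 : syzygy q p (Sum.inl 1) = p (.modσ 0) + p (.modτ 0) := rfl
    have eσ : syzygy q p (Sum.inl σ) = p (.modσ 0) + p (.modτ 1) := rfl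
    have eτ : syzygy q p (Sum.inl τ) = p (.modσ 1) + p (.modτ 0) := rfl
    have eστ : syzygy q p (Sum.inl (σ * τ)) = p (.modσ 1) + p (.modτ 1) := rfl
    rw [augmentation_apply, syzygy_inr, e1, eσ, eτ, eστ]
    simp only [map_add]
    ext j
    · simp only [Pi.add_apply, Prod.fst_zero, Pi.zero_apply]
      linear_combination CharTwo.add_self_eq_zero (p (.modσ 0) j + p (.modσ 1) j +
        p (.modτ 0) j + p (.modτ 1) j)
    · simp only [Pi.add_apply, Prod.snd_zero, Pi.zero_apply]
      linear_combination CharTwo.add_self_eq_zero (p (.modσ 0) j + p (.modσ 1) j +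
        p (.modτ 1) j + shift q (p (.modσ 1)) j + shift q (p (.modτ 0)) j +
        shift q (p (.modτ 1)) j)

theorem exact_constants_syzygy : Function.Exact (constants q) (syzygy q) := by
  intro p
  constructor
  · intro hp
    have h (g : KleinFour) : p (.modσ g.toAdd.2) =
        p (.modτ g.toAdd.1) :=
      (add_eq_zero_iff_eq k).1 (congrFun hp (Sum.inl g))
    refine ⟨fun _ => p (.modσ 0), ?_⟩
    ext1 y
    change p (.modσ 0) = p y
    rcases y with c | c
    · exact (h (.ofAdd (0, 0))).trans (h (.ofAdd (0, c))).symm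
    · exact h (.ofAdd (c, 0))
  · rintro ⟨u, rfl⟩
    ext1 y
    rcases y with g | y
    · exact add_self_eq_zero k _
    · obtain rfl : y = () := rfl
      rw [syzygy_inr]
      change u () + u () + shift q (u () + u ()) = 0
      rw [add_self_eq_zero k, map_zero, add_zero]

end Resolution

end EModule

theorem mainTheorem6 {k : Type*} [Field k] [CharP k 2] (n : ℕ) (hn : 1 ≤ n) (f : k[X])
    (hmonic : f.Monic) (hirr : Irreducible f) (hf0 : f ≠ X) (hf1 : f ≠ X + 1) :
    ppdim 2 (EModule f n) = 2 := by
  have hperm {m : ℕ} {Y : Type} [Finite Y] [MulAction KleinFour Y] :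
      IsPPermutation 2 (Rep.of (KleinFour.funRep k (Fin m → k) Y)) :=
    (isPPermutation_iff_isPermutation KleinFour.isPGroup _).2 (KleinFour.isPermutation_funRep m)
  refine le_antisymm ?_ ?_
  · exact ppdim_le_two hperm hperm hperm (Rep.ofHom (EModule.constants (f ^ n)))
      (Rep.ofHom (EModule.syzygy (f ^ n))) (Rep.ofHom (EModule.augmentation (f ^ n)))
      EModule.injective_constants EModule.exact_constants_syzygy
      EModule.exact_syzygy_augmentation EModule.surjective_augmentation
  · have heval : ∀ c : k, f ≠ X - C c → (f ^ n).eval c ≠ 0 := by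
      intro c hc h
      rw [eval_pow] at h
      have hdvd : X - C c ∣ f := dvd_iff_isRoot.2 (pow_eq_zero_iff (by omega) |>.1 h)
      exact hc (eq_of_monic_of_associated hmonic (monic_X_sub_C c)
        ((irreducible_X_sub_C c).associated_of_dvd hirr hdvd).symm)
    have h0 : (f ^ n).eval 0 ≠ 0 := heval 0 (by simpa using hf0)
    have h1 : (f ^ n).eval 1 ≠ 0 := heval 1 (by
      rwa [map_one, CharTwo.sub_eq_add])
    have hq : (f ^ n).Monic := hmonic.pow n
    have hdeg : 0 < (f ^ n).natDegree := by
      rw [natDegree_pow]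
      exact Nat.mul_pos hn hirr.natDegree_pos
    have : Nonempty (Fin (f ^ n).natDegree) := ⟨⟨0, hdeg⟩⟩
    have : Nontrivial (EModule f n) := inferInstanceAs
      (Nontrivial ((Fin (f ^ n).natDegree → k) × (Fin (f ^ n).natDegree → k)))
    refine two_le_ppdim fun A₁ A₀ d ε hA₁ hA₀ hd hε => ?_
    rw [isPPermutation_iff_isPermutation KleinFour.isPGroup] at hA₁ hA₀
    obtain ⟨ι₁, _, _, b₁, hb₁⟩ := KleinFour.exists_mulAction_of_isPermutation hA₁
    obtain ⟨ι₀, _, _, b₀, hb₀⟩ := KleinFour.exists_mulAction_of_isPermutation hA₀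
    exact KleinFour.not_exact_of_permutation hb₁ hb₀ hd hε
      (fun g hg => EModule.mem_range_pairNorm_rho hq h0 h1 hg) EModule.fullNorm_rho
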